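/- Let $M$ be a smooth manifold (without boundary, finite-dimensional). For a Riemannian metric $g$ on $M$ with Levi-Civita connection $\nabla$, write $R(X,Y)Z=\nabla_X\nabla_YZ-\nabla_Y\nabla_XZ-\nabla_{[X,Y]}Z$, and for a smooth function $f$ on $M$ and $U,V,W\in T_pM$ set $$(\overline R^{g})_f^{U}(V,W)=g\big(R(V,U)U,W\big)+\Big(\tfrac12 (L_{\nabla f}g)(U,U)+g(\nabla f,U)^2\Big)\,g(V,W),$$ and, for a $g$-orthonormal pair $(U,V)$ in $T_pM$, $$\overline{\mathrm{sec}}^{\,g}_f(U,V)=\mathrm{sec}^g(U,V)+\tfrac12 (L_{\nabla f}g)(U,U)+g(\nabla f,U)^2,$$ where $\nabla f$ is the $g$-gradient and $\mathrm{sec}^g(U,V)$ is the sectional curvature of the plane spanned by $U$ and $V$. For a function $\varphi:M\to\mathbb R$, the condition $\overline{\mathrm{sec}}^{\,g}_f=\varphi$ (resp. $\ge 0$, $\le 0$) means that $\overline{\mathrm{sec}}^{\,g}_f(U,V)=\varphi(p)$ (resp. $\ge 0$, $\le 0$) for every $p\in M$ and every $g$-orthonormal pair $(U,V)$ in $T_pM$.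 Let $g$ be a Riemannian metric on $M$, $f$ a smooth function on $M$, and $h=e^{-2f}g$. Then: (1) for all $p\in M$ and all $U,V\in T_pM$ with $g(U,V)=0$, $$(\overline R^{g})_f^{U}(V,V)=e^{2f(p)}\,(\overline R^{h})_{-f}^{V}(U,U);$$ (2) for every $p\in M$ and every $g$-orthonormal pair $(U,V)$ in $T_pM$, the pair $(e^{f(p)}V,e^{f(p)}U)$ is $h$-orthonormal and $$\overline{\mathrm{sec}}^{\,g}_f(U,V)=e^{-2f(p)}\,\overline{\mathrm{sec}}^{\,h}_{-f}\big(e^{f(p)}V,e^{f(p)}U\big);$$ (3) the map $(g,f)\mapsto(e^{-2f}g,-f)$ is an involution on the set of pairs of a Riemannian metric and a smooth function on $M$, and it preserves the conditions on $\overline{\mathrm{sec}}$ in the following sense: $\overline{\mathrm{sec}}^{\,g}_f=\varphi$ if and only if $\overline{\mathrm{sec}}^{\,h}_{-f}=e^{2f}\varphi$, for every function $\varphi:M\to\mathbb R$; $\overline{\mathrm{sec}}^{\,g}_f\ge0$ if and only if $\overline{\mathrm{sec}}^{\,h}_{-f}\ge0$; and $\overline{\mathrm{sec}}^{\,g}_f\le0$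 if and only if $\overline{\mathrm{sec}}^{\,h}_{-f}\le0$. -/

import Mathlib

open scoped Manifold ContDiff

namespace WeightedCurvature

noncomputable section

/-! ### Riemannian calculus on an open part of a vector space

Here `G` is a metric written in coordinates, a field of bilinear forms on `E`; the vector fields
`X`, `Y`, … are maps `E → E`. -/

section Coordinates

variable {E : Type*} [NormedAddCommGroup E] [NormedSpace ℝ E]

/-- The Christoffel symbols `Γ(u, v)` of `G` at `y`, determined by
`2 G(Γ(u, v), w) = (D_u G)(v, w) + (D_v G)(u, w) - (D_w G)(u, v)` for all `w`.
The inverse is that of the isomorphism `E → E*`, `u ↦ G y u`. -/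
def christoffel (G : E → E →L[ℝ] E →L[ℝ] ℝ) (y : E) (u v : E) : E :=
  (G y).inverse ((1 / 2 : ℝ) •
    (fderiv ℝ G y u v + fderiv ℝ G y v u - ((fderiv ℝ G y).flip u).flip v))

/-- The Levi-Civita covariant derivative `∇_X Y` in coordinates. -/
def covDeriv (G : E → E →L[ℝ] E →L[ℝ] ℝ) (X Y : E → E) : E → E :=
  fun y ↦ fderiv ℝ Y y (X y) + christoffel G y (X y) (Y y)

/-- `R(X, Y) Z = ∇_X ∇_Y Z - ∇_Y ∇_X Z - ∇_[X, Y] Z` in coordinates. -/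
def coordCurvature (G : E → E →L[ℝ] E →L[ℝ] ℝ) (X Y Z : E → E) : E → E :=
  covDeriv G X (covDeriv G Y Z) - covDeriv G Y (covDeriv G X Z)
    - covDeriv G (VectorField.lieBracket ℝ X Y) Z

/-- `(L_X G)(Y, Z) = X (G(Y, Z)) - G([X, Y], Z) - G(Y, [X, Z])` in coordinates. -/
def coordLieDeriv (G : E → E →L[ℝ] E →L[ℝ] ℝ) (X Y Z : E → E) (y : E) : ℝ :=
  fderiv ℝ (fun z ↦ G z (Y z) (Z z)) y (X y)
    - G y (VectorField.lieBracket ℝ X Y y) (Z y)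
    - G y (Y y) (VectorField.lieBracket ℝ X Z y)

end Coordinates

/-! ### Riemannian manifolds -/

section Manifold

variable {E : Type*} [NormedAddCommGroup E] [NormedSpace ℝ E]
  {H : Type*} [TopologicalSpace H] {I : ModelWithCorners ℝ E H}
  {M : Type*} [TopologicalSpace M] [ChartedSpace H M] [IsManifold I ∞ M]

variable (I M) in
/-- Smooth Riemannian metrics on `M`. -/
abbrev Metric := Bundle.ContMDiffRiemannianMetric I ∞ E (TangentSpace I : M → Type _)

/-- The differential at `p` of the chart around `p`, as a map `T_p M → E`. -/
def chartDeriv (p : M) : TangentSpace I p →L[ℝ] E :=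
  mfderiv I 𝓘(ℝ, E) (extChartAt I p) p

/-- The differential at `y` of the inverse of the chart around `p`. -/
def chartSymmDeriv (p : M) (y : E) : E →L[ℝ] TangentSpace I ((extChartAt I p).symm y) :=
  mfderiv 𝓘(ℝ, E) I (extChartAt I p).symm y

/-- The metric `g` written in the chart around `p`: its pullback by the inverse of the chart. -/
def chartMetric (g : Metric I M) (p : M) (y : E) : E →L[ℝ] E →L[ℝ] ℝ :=
  (ContinuousLinearMap.precomp ℝ (chartSymmDeriv (I := I) p y)) ∘L
    (g.inner ((extChartAt I p).symm y)) ∘L (chartSymmDeriv (I := I) p y)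

/-- The vector field `X` written in the chart around `p`. -/
def chartField (X : Π q : M, TangentSpace I q) (p : M) (y : E) : E :=
  (chartSymmDeriv (I := I) p y).inverse (X ((extChartAt I p).symm y))

/-- The curvature tensor `R(u, v) w` of `g` at `p`. It is computed in the chart around `p`,
extending `u`, `v`, `w` by vector fields that are constant in that chart. -/
def curvature (g : Metric I M) (p : M) (u v w : TangentSpace I p) : TangentSpace I p :=
  (chartDeriv p).inverse
    (coordCurvature (chartMetric g p) (fun _ ↦ chartDeriv p u) (fun _ ↦ chartDeriv p v)
      (fun _ ↦ chartDeriv p w) (extChartAt I p p))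

/-- The Lie derivative `(L_X g)(v, w)` at `p`. It is computed in the chart around `p`,
extending `v`, `w` by vector fields that are constant in that chart. -/
def lieDeriv (g : Metric I M) (X : Π q : M, TangentSpace I q) (p : M)
    (v w : TangentSpace I p) : ℝ :=
  coordLieDeriv (chartMetric g p) (chartField X p) (fun _ ↦ chartDeriv p v)
    (fun _ ↦ chartDeriv p w) (extChartAt I p p)

/-- The gradient of `f`, determined by `g(∇f, v) = df(v)` for all `v`. -/
def gradient (g : Metric I M) (f : C^∞⟮I, M; ℝ⟯) (p : M) : TangentSpace I p :=
  (g.inner p).inverse (mfderiv I 𝓘(ℝ, ℝ) f p)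

/-- The directional curvature operator `R^V(U) = R(U, V) V`. -/
def directional (g : Metric I M) (p : M) (V U : TangentSpace I p) : TangentSpace I p :=
  curvature g p U V V

/-- The sectional curvature of the plane spanned by `V` and `U`. -/
def sectional (g : Metric I M) (p : M) (V U : TangentSpace I p) : ℝ :=
  g.inner p (directional g p V U) U /
    (g.inner p V V * g.inner p U U - g.inner p V U ^ 2)

/-- The (strongly) weighted directional curvature operator
`R̄_X^V(U) = R^V(U) + (½ (L_X g)(V, V) + g(X, V)²) U`. -/
def weightedDirectionalOp (g : Metric I M) (X : Π q : M, TangentSpace I q) (p : M)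
    (V U : TangentSpace I p) : TangentSpace I p :=
  directional g p V U + (1 / 2 * lieDeriv g X p V V + g.inner p (X p) V ^ 2) • U

/-- `R̄_X^V(U, W) = g(R̄_X^V(U), W)`. -/
def weightedDirectional (g : Metric I M) (X : Π q : M, TangentSpace I q) (p : M)
    (V U W : TangentSpace I p) : ℝ :=
  g.inner p (weightedDirectionalOp g X p V U) W

/-- The pair `(V, U)` of tangent vectors at `p` is `g`-orthonormal. -/
def IsOrthonormalPair (g : Metric I M) (p : M) (V U : TangentSpace I p) : Prop :=
  g.inner p V V = 1 ∧ g.inner p U U = 1 ∧ g.inner p V U = 0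

/-- The (strongly) weighted sectional curvature
`sec̄_X^V(U) = sec(V, U) + ½ (L_X g)(V, V) + g(X, V)²`, meant for orthonormal pairs `(V, U)`. -/
def weightedSec (g : Metric I M) (X : Π q : M, TangentSpace I q) (p : M)
    (V U : TangentSpace I p) : ℝ :=
  sectional g p V U + 1 / 2 * lieDeriv g X p V V + g.inner p (X p) V ^ 2

/-- `R̄_f^V(U, W)`, the case `X = ∇f`. -/
def weightedDirectionalFun (g : Metric I M) (f : C^∞⟮I, M; ℝ⟯) (p : M)
    (V U W : TangentSpace I p) : ℝ :=
  weightedDirectional g (gradient g f) p V U W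

/-- `sec̄_f^V(U)`, the case `X = ∇f`. -/
def weightedSecFun (g : Metric I M) (f : C^∞⟮I, M; ℝ⟯) (p : M)
    (V U : TangentSpace I p) : ℝ :=
  weightedSec g (gradient g f) p V U

/-- The condition `sec̄_f = φ`. -/
def WeightedSecEq (g : Metric I M) (f : C^∞⟮I, M; ℝ⟯) (φ : M → ℝ) : Prop :=
  ∀ (p : M) (V U : TangentSpace I p), IsOrthonormalPair g p V U → weightedSecFun g f p V U = φ p

/-- The condition `sec̄_f ≥ φ`. -/
def WeightedSecGe (g : Metric I M) (f : C^∞⟮I, M; ℝ⟯) (φ : M → ℝ) : Prop :=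
  ∀ (p : M) (V U : TangentSpace I p), IsOrthonormalPair g p V U → φ p ≤ weightedSecFun g f p V U

/-- The condition `sec̄_f ≤ φ`. -/
def WeightedSecLe (g : Metric I M) (f : C^∞⟮I, M; ℝ⟯) (φ : M → ℝ) : Prop :=
  ∀ (p : M) (V U : TangentSpace I p), IsOrthonormalPair g p V U → weightedSecFun g f p V U ≤ φ p

/-- The conformal metric `e^{-2f} g`. -/
def conformal (g : Metric I M) (f : C^∞⟮I, M; ℝ⟯) : Metric I M where
  inner p := Real.exp (-2 * f p) • g.inner p
  symm p v w := by
    simp [g.symm p v w]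
  pos p v hv := by
    have := g.pos p v hv
    simp only [smul_apply, smul_eq_mul]
    positivity
  isVonNBounded p := by
    have h := (g.isVonNBounded p).image
      ((Real.exp (f p)) • ContinuousLinearMap.id ℝ (TangentSpace I p))
    refine h.subset ?_
    intro v hv
    refine ⟨Real.exp (-f p) • v, ?_, ?_⟩
    · have e : Real.exp (-2 * f p) = Real.exp (-f p) * Real.exp (-f p) := by
        rw [← Real.exp_add]; ring_nf
      simp only [Set.mem_ofPred_eq, smul_apply, smul_eq_mul, e] at hv
      simp only [Set.mem_ofPred_eq, map_smul, smul_apply, smul_eq_mul]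
      linarith
    · simp [smul_smul, ← Real.exp_add]
  contMDiff := by
    have hf : ContMDiff I 𝓘(ℝ, ℝ) ∞ (fun p : M ↦ Real.exp (-2 * f p)) :=
      (Real.contDiff_exp.comp (contDiff_const.mul contDiff_id)).contMDiff.comp f.contMDiff
    exact hf.smul_section g.contMDiff

/-- The map `(g, f) ↦ (e^{-2f} g, -f)` on Riemannian metrics with density. -/
def conformalDual (P : Metric I M × C^∞⟮I, M; ℝ⟯) : Metric I M × C^∞⟮I, M; ℝ⟯ :=
  (conformal P.1 P.2, -P.2)

end Manifold

end

end WeightedCurvature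

/-!
The theorem is a pointwise identity, and every quantity in it is defined by its expression in the
chart around the point `p`, so everything reduces to a computation in coordinates for a metric `G`
and a function `φ` near a point of `E`.

For constant fields `u`, `v`, compatibility of the connection with the metric gives
`G(R(u, v)v, u) = ∂_u∂_v G(u, v) - ½ ∂_u² G(v, v) - ½ ∂_v² G(u, u) - G(Γ(u, u), Γ(v, v))
+ G(Γ(u, v), Γ(u, v))` (`IsCoordMetricAt.apply_coordCurvature`), an expression symmetric in `u` and
`v`, and half the Lie derivative along a gradient is the Hessian
`∂_v² φ - dφ(Γ(v, v))` (`IsCoordMetricAt.half_coordLieDeriv`). Under `G ↦ e^{-2φ} G` the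
Christoffel symbols become `Γ(u, v) - dφ(u) v - dφ(v) u + G(u, v) ∇φ`. If `G(u, v) = 0`, then
`e^{2φ}` times the new value of `G(R(u, v)v, u)` exceeds the old one by
`(Hess φ(u, u) + dφ(u)²) G(v, v) + (Hess φ(v, v) + dφ(v)²) G(u, u) - G(u, u) G(v, v) |∇φ|²`. The
first term is the weight on the side of `G`; the other two are, up to sign, the weight on the side
of `e^{-2φ} G`, whose Hessian of `-φ` in the direction `v` brings in the `|∇φ|²`. The result is the
duality `IsCoordMetricAt.coordWeightedDirectional_coordConformal`.

On the manifold, a Riemannian metric is smooth and nondegenerate in a chart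
(`isCoordMetricAt_chartMetric`) and gradients correspond (`chartField_gradient`), which gives the
identity for directional curvatures. The one for sectional curvatures follows by homogeneity. The
equivalences need one direction only, as the duality is an involution.
-/

namespace WeightedCurvature

/-! ### Curvature and Lie derivative in coordinates -/

section CoordinateFormulas

-- Needed for the instances on the trilinear and quadrilinear maps `fderiv ℝ G y` and
-- `fderiv ℝ (fderiv ℝ G) y`.
set_option maxSynthPendingDepth 6

open Filter Topology

variable {E : Type*} [NormedAddCommGroup E] [NormedSpace ℝ E]
  {G : E → E →L[ℝ] E →L[ℝ] ℝ} {φ : E → ℝ} {x : E}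

/-- `G` is a symmetric form in coordinates, nondegenerate near `x` and of class `C^2` at `x`.
Symmetry is required everywhere, which is no restriction for metrics pulled back by charts. -/
structure IsCoordMetricAt (G : E → E →L[ℝ] E →L[ℝ] ℝ) (x : E) : Prop where
  contDiffAt : ContDiffAt ℝ 2 G x
  symm : ∀ y u v, G y u v = G y v u
  isInvertible : ∀ᶠ y in 𝓝 x, (G y).IsInvertible

/-- The gradient of `φ` with respect to `G`, in coordinates. -/
noncomputable def coordGradient (G : E → E →L[ℝ] E →L[ℝ] ℝ) (φ : E → ℝ) (y : E) : E :=
  (G y).inverse (fderiv ℝ φ y)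

theorem apply_coordGradient {y : E} (h : (G y).IsInvertible) (w : E) :
    G y (coordGradient G φ y) w = fderiv ℝ φ y w := by
  rw [coordGradient, h.self_apply_inverse]

theorem apply_christoffel {y : E} (h : (G y).IsInvertible) (u v w : E) :
    G y (christoffel G y u v) w =
      1 / 2 * (fderiv ℝ G y u v w + fderiv ℝ G y v u w - fderiv ℝ G y w u v) := by
  rw [christoffel, h.self_apply_inverse]
  simp

theorem _root_.DifferentiableAt.fderiv_apply_apply_const {F : Type*} [NormedAddCommGroup F]
    [NormedSpace ℝ F] {A : F → E →L[ℝ] E →L[ℝ] ℝ} {y : F} (h : DifferentiableAt ℝ A y)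
    (u v : E) (w : F) : fderiv ℝ (fun z ↦ A z u v) y w = fderiv ℝ A y w u v := by
  have := ((h.hasFDerivAt.clm_apply (hasFDerivAt_const u y)).clm_apply (hasFDerivAt_const v y))
  rw [this.fderiv]
  simp

/-- The product rule for a form evaluated on a varying vector and a constant one. -/
theorem _root_.DifferentiableAt.fderiv_apply_apply_left {A : E → E →L[ℝ] E →L[ℝ] ℝ} {X : E → E}
    {y : E} (h : DifferentiableAt ℝ A y) (hX : DifferentiableAt ℝ X y) (v w : E) :
    fderiv ℝ (fun z ↦ A z (X z) v) y w = fderiv ℝ A y w (X y) v + A y (fderiv ℝ X y w) v := by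
  have := ((h.hasFDerivAt.clm_apply hX.hasFDerivAt).clm_apply (hasFDerivAt_const v y))
  rw [this.fderiv]
  simp [add_comm]

namespace IsCoordMetricAt

theorem eventually_differentiableAt (hG : IsCoordMetricAt G x) :
    ∀ᶠ y in 𝓝 x, DifferentiableAt ℝ G y :=
  (hG.contDiffAt.eventually (by simp)).mono fun _ h ↦ h.differentiableAt (by simp)

theorem differentiableAt_fderiv (hG : IsCoordMetricAt G x) :
    DifferentiableAt ℝ (fderiv ℝ G) x :=
  (hG.contDiffAt.fderiv_right (m := 1) (by norm_num)).differentiableAt (by simp)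

theorem fderiv_symm (hG : IsCoordMetricAt G x) (w u v : E) :
    fderiv ℝ G x w u v = fderiv ℝ G x w v u := by
  have h := hG.eventually_differentiableAt.self_of_nhds
  rw [← h.fderiv_apply_apply_const, ← h.fderiv_apply_apply_const]
  simp_rw [hG.symm _ u v]

theorem fderiv_fderiv_symm (hG : IsCoordMetricAt G x) (a b c d : E) :
    fderiv ℝ (fderiv ℝ G) x a b c d = fderiv ℝ (fderiv ℝ G) x a b d c := by
  have key : ∀ c d : E, HasFDerivAt (fun y ↦ fderiv ℝ G y b c d) _ x := fun c d ↦
    ((hG.differentiableAt_fderiv.hasFDerivAt.clm_apply (hasFDerivAt_const b x)).clm_apply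
      (hasFDerivAt_const c x)).clm_apply (hasFDerivAt_const d x)
  have h : (fun y ↦ fderiv ℝ G y b c d) =ᶠ[𝓝 x] fun y ↦ fderiv ℝ G y b d c :=
    hG.eventually_differentiableAt.mono fun y hy ↦ by
      simp only [← hy.fderiv_apply_apply_const]
      simp_rw [hG.symm _ c d]
  have h' := h.fderiv_eq (𝕜 := ℝ)
  rw [(key c d).fderiv, (key d c).fderiv] at h'
  simpa using congrArg (fun L : E →L[ℝ] ℝ ↦ L a) h'

theorem christoffel_symm (hG : IsCoordMetricAt G x) (u v : E) :
    christoffel G x u v = christoffel G x v u := by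
  have h := hG.isInvertible.self_of_nhds
  apply h.injective
  ext w
  rw [apply_christoffel h, apply_christoffel h, hG.fderiv_symm w u v]
  ring

/-- The Levi-Civita connection is compatible with the metric. -/
theorem fderiv_eq_christoffel (hG : IsCoordMetricAt G x) (w u v : E) :
    fderiv ℝ G x w u v = G x (christoffel G x w u) v + G x (christoffel G x w v) u := by
  have h := hG.isInvertible.self_of_nhds
  rw [apply_christoffel h, apply_christoffel h, hG.fderiv_symm w v u]
  ring

theorem differentiableAt_inverse [CompleteSpace E] (hG : IsCoordMetricAt G x) :
    DifferentiableAt ℝ (fun y ↦ (G y).inverse) x := by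
  have h := hG.isInvertible.self_of_nhds.contDiffAt_map_inverse (n := 1)
  exact (h.differentiableAt (by simp)).comp x hG.eventually_differentiableAt.self_of_nhds

theorem differentiableAt_christoffel [CompleteSpace E] (hG : IsCoordMetricAt G x) (u v : E) :
    DifferentiableAt ℝ (fun y ↦ christoffel G y u v) x := by
  have h := hG.differentiableAt_fderiv
  have h₁ : ∀ a b : E, DifferentiableAt ℝ (fun y ↦ fderiv ℝ G y a b) x := fun a b ↦
    (h.clm_apply (differentiableAt_const a)).clm_apply (differentiableAt_const b)
  have h₂ : DifferentiableAt ℝ (fun y ↦ ((fderiv ℝ G y).flip u).flip v) x := by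
    have h₃ : DifferentiableAt ℝ (fun y ↦ (fderiv ℝ G y).flip) x :=
      (ContinuousLinearMap.flipₗᵢ ℝ E E (E →L[ℝ] ℝ)).differentiableAt.comp x h
    have h₄ := h₃.clm_apply (differentiableAt_const u)
    exact ((ContinuousLinearMap.flipₗᵢ ℝ E E ℝ).differentiableAt.comp x h₄).clm_apply
      (differentiableAt_const v)
  exact hG.differentiableAt_inverse.clm_apply
    ((((h₁ u v).add (h₁ v u)).sub h₂).const_smul (1 / 2 : ℝ))

/-- The derivative of a Christoffel symbol, with the index lowered. -/
theorem apply_fderiv_christoffel [CompleteSpace E] (hG : IsCoordMetricAt G x) (a u v w : E) :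
    G x (fderiv ℝ (fun y ↦ christoffel G y u v) x a) w =
      1 / 2 * (fderiv ℝ (fderiv ℝ G) x a u v w + fderiv ℝ (fderiv ℝ G) x a v u w
        - fderiv ℝ (fderiv ℝ G) x a w u v)
      - fderiv ℝ G x a (christoffel G x u v) w := by
  have hd := hG.eventually_differentiableAt.self_of_nhds
  have key : ∀ b c d : E, HasFDerivAt (fun y ↦ fderiv ℝ G y b c d) _ x := fun b c d ↦
    ((hG.differentiableAt_fderiv.hasFDerivAt.clm_apply (hasFDerivAt_const b x)).clm_apply
      (hasFDerivAt_const c x)).clm_apply (hasFDerivAt_const d x)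
  have h₁ := hd.fderiv_apply_apply_left (hG.differentiableAt_christoffel u v) w a
  have h₂ : (fun y ↦ G y (christoffel G y u v) w) =ᶠ[𝓝 x] fun y ↦
      1 / 2 * (fderiv ℝ G y u v w + fderiv ℝ G y v u w - fderiv ℝ G y w u v) :=
    hG.isInvertible.mono fun y hy ↦ apply_christoffel hy u v w
  have h₃ : HasFDerivAt (fun y ↦
      1 / 2 * (fderiv ℝ G y u v w + fderiv ℝ G y v u w - fderiv ℝ G y w u v)) _ x :=
    (((key u v w).add (key v u w)).sub (key w u v)).const_mul (1 / 2 : ℝ)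
  rw [h₂.fderiv_eq, h₃.fderiv] at h₁
  simp at h₁
  linarith

theorem coordCurvature_const (u v w : E) :
    coordCurvature G (fun _ ↦ u) (fun _ ↦ v) (fun _ ↦ w) x =
      fderiv ℝ (fun y ↦ christoffel G y v w) x u + christoffel G x u (christoffel G x v w)
        - (fderiv ℝ (fun y ↦ christoffel G y u w) x v
          + christoffel G x v (christoffel G x u w)) := by
  have hb : VectorField.lieBracket ℝ (fun _ : E ↦ u) (fun _ : E ↦ v) = 0 := by
    ext y
    simp [VectorField.lieBracket]
  have h₀ : ∀ a : E, christoffel G x 0 a = 0 := fun a ↦ by simp [christoffel]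
  have hc : ∀ a b : E, covDeriv G (fun _ ↦ a) (fun _ ↦ b) = fun y ↦ christoffel G y a b :=
    fun a b ↦ by ext y; simp [covDeriv]
  simp only [coordCurvature, hb, hc, Pi.sub_apply]
  simp [covDeriv, h₀]

/-- The value of `G(R(u, v)v, u)` in coordinates, in terms of the second derivatives of `G` and
of the Christoffel symbols. -/
theorem apply_coordCurvature [CompleteSpace E] (hG : IsCoordMetricAt G x) (u v : E) :
    G x (coordCurvature G (fun _ ↦ u) (fun _ ↦ v) (fun _ ↦ v) x) u =
      fderiv ℝ (fderiv ℝ G) x u v u v - 1 / 2 * fderiv ℝ (fderiv ℝ G) x u u v v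
        - 1 / 2 * fderiv ℝ (fderiv ℝ G) x v v u u
        - G x (christoffel G x u u) (christoffel G x v v)
        + G x (christoffel G x u v) (christoffel G x u v) := by
  have hsymm : ∀ a b : E, fderiv ℝ (fderiv ℝ G) x a b = fderiv ℝ (fderiv ℝ G) x b a :=
    fun a b ↦ (hG.contDiffAt.isSymmSndFDerivAt (by simp)) a b
  rw [coordCurvature_const]
  -- Metric compatibility cancels the terms `G(Γ(u, Γ(v, v)), u)` and `G(Γ(v, Γ(u, v)), u)`.
  simp only [map_add, map_sub, add_apply, sub_apply, hG.apply_fderiv_christoffel,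
    hG.fderiv_eq_christoffel]
  rw [hG.christoffel_symm v u, hsymm v u, hG.fderiv_fderiv_symm u v v u]
  ring

end IsCoordMetricAt

/-- Half the Lie derivative of the metric along a gradient is the Hessian. -/
theorem IsCoordMetricAt.half_coordLieDeriv [CompleteSpace E] (hG : IsCoordMetricAt G x)
    (hφ : ContDiffAt ℝ 2 φ x) (v : E) :
    1 / 2 * coordLieDeriv G (coordGradient G φ) (fun _ ↦ v) (fun _ ↦ v) x =
      fderiv ℝ (fderiv ℝ φ) x v v - fderiv ℝ φ x (christoffel G x v v) := by
  have hi := hG.isInvertible.self_of_nhds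
  have hd := hG.eventually_differentiableAt.self_of_nhds
  have hφ' : DifferentiableAt ℝ (fderiv ℝ φ) x :=
    (hφ.fderiv_right (m := 1) (by norm_num)).differentiableAt (by simp)
  have hX : DifferentiableAt ℝ (coordGradient G φ) x := hG.differentiableAt_inverse.clm_apply hφ'
  have h₁ := hd.fderiv_apply_apply_left hX v v
  have h₂ : (fun y ↦ G y (coordGradient G φ y) v) =ᶠ[𝓝 x] fun y ↦ fderiv ℝ φ y v :=
    hG.isInvertible.mono fun y hy ↦ apply_coordGradient hy v
  rw [h₂.fderiv_eq, (hφ'.hasFDerivAt.clm_apply (hasFDerivAt_const v x)).fderiv] at h₁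
  simp at h₁
  rw [coordLieDeriv, hd.fderiv_apply_apply_const, ← apply_coordGradient hi,
    hG.symm x _ (christoffel G x v v), apply_christoffel hi, h₁]
  simp [VectorField.lieBracket]
  rw [hG.symm x v, hG.fderiv_symm v v]
  ring

end CoordinateFormulas

/-! ### Conformal change in coordinates -/

section ConformalCoordinates

-- Needed for the instances on the trilinear and quadrilinear maps `fderiv ℝ G y` and
-- `fderiv ℝ (fderiv ℝ G) y`.
set_option maxSynthPendingDepth 6

open Filter Topology

variable {E : Type*} [NormedAddCommGroup E] [NormedSpace ℝ E]
  {G : E → E →L[ℝ] E →L[ℝ] ℝ} {φ : E → ℝ} {x : E}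

/-- The conformal metric `e^{-2φ} G` in coordinates. -/
noncomputable def coordConformal (G : E → E →L[ℝ] E →L[ℝ] ℝ) (φ : E → ℝ) (y : E) :
    E →L[ℝ] E →L[ℝ] ℝ :=
  Real.exp (-2 * φ y) • G y

theorem coordConformal_apply (y u v : E) :
    coordConformal G φ y u v = Real.exp (-2 * φ y) * G y u v := by
  simp [coordConformal]

namespace IsCoordMetricAt

theorem conformal (hG : IsCoordMetricAt G x) (hφ : ContDiffAt ℝ 2 φ x) :
    IsCoordMetricAt (coordConformal G φ) x where
  contDiffAt := (Real.contDiff_exp.contDiffAt.comp x (contDiffAt_const.mul hφ)).smul hG.contDiffAt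
  symm y u v := by rw [coordConformal_apply, coordConformal_apply, hG.symm]
  isInvertible := hG.isInvertible.mono fun y hy ↦ by
    obtain ⟨e, he⟩ := hy
    have h₀ := Real.exp_ne_zero (-2 * φ y)
    refine ⟨(ContinuousLinearEquiv.smulLeft (Units.mk0 _ h₀)).trans e, ?_⟩
    ext u v
    simp [coordConformal_apply, ← he, Units.smul_def]

end IsCoordMetricAt

theorem hasFDerivAt_exp_neg_two_mul {y : E} (hφ : DifferentiableAt ℝ φ y) :
    HasFDerivAt (fun z ↦ Real.exp (-2 * φ z))
      (Real.exp (-2 * φ y) • ((-2 : ℝ) • fderiv ℝ φ y)) y :=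
  (hφ.hasFDerivAt.const_mul (-2)).exp

theorem fderiv_coordConformal {y : E} (hG : DifferentiableAt ℝ G y)
    (hφ : DifferentiableAt ℝ φ y) (w u v : E) :
    fderiv ℝ (coordConformal G φ) y w u v =
      Real.exp (-2 * φ y) * (fderiv ℝ G y w u v - 2 * fderiv ℝ φ y w * G y u v) := by
  have h : HasFDerivAt (coordConformal G φ) _ y :=
    (hasFDerivAt_exp_neg_two_mul hφ).smul hG.hasFDerivAt
  rw [h.fderiv]
  simp
  ring

/-- The second derivatives of `e^{-2φ} G`. -/
theorem IsCoordMetricAt.fderiv_fderiv_coordConformal (hG : IsCoordMetricAt G x)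
    (hφ : ContDiffAt ℝ 2 φ x) (a w u v : E) :
    fderiv ℝ (fderiv ℝ (coordConformal G φ)) x a w u v =
      Real.exp (-2 * φ x) * (fderiv ℝ (fderiv ℝ G) x a w u v
        - 2 * fderiv ℝ φ x w * fderiv ℝ G x a u v - 2 * fderiv ℝ φ x a * fderiv ℝ G x w u v
        + (4 * fderiv ℝ φ x a * fderiv ℝ φ x w - 2 * fderiv ℝ (fderiv ℝ φ) x a w) * G x u v) := by
  have hφ' : DifferentiableAt ℝ (fderiv ℝ φ) x :=
    (hφ.fderiv_right (m := 1) (by norm_num)).differentiableAt (by simp)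
  have hφd : ∀ᶠ y in 𝓝 x, DifferentiableAt ℝ φ y :=
    (hφ.eventually (by simp)).mono fun _ h ↦ h.differentiableAt (by simp)
  have key : ∀ {A : E → E →L[ℝ] E →L[ℝ] ℝ}, IsCoordMetricAt A x →
      HasFDerivAt (fun y ↦ fderiv ℝ A y w u v) _ x := fun hA ↦
    ((hA.differentiableAt_fderiv.hasFDerivAt.clm_apply (hasFDerivAt_const w x)).clm_apply
      (hasFDerivAt_const u x)).clm_apply (hasFDerivAt_const v x)
  have hGd := hG.eventually_differentiableAt.self_of_nhds.hasFDerivAt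
  have h₁ : HasFDerivAt (fun y ↦
      Real.exp (-2 * φ y) * (fderiv ℝ G y w u v - 2 * fderiv ℝ φ y w * G y u v)) _ x :=
    (hasFDerivAt_exp_neg_two_mul hφd.self_of_nhds).mul ((key hG).sub
      (((hφ'.hasFDerivAt.clm_apply (hasFDerivAt_const w x)).const_mul 2).mul
        ((hGd.clm_apply (hasFDerivAt_const u x)).clm_apply (hasFDerivAt_const v x))))
  have h₂ : (fun y ↦ fderiv ℝ (coordConformal G φ) y w u v) =ᶠ[𝓝 x] fun y ↦
      Real.exp (-2 * φ y) * (fderiv ℝ G y w u v - 2 * fderiv ℝ φ y w * G y u v) := by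
    filter_upwards [hG.eventually_differentiableAt, hφd] with y hy hy'
    exact fderiv_coordConformal hy hy' w u v
  have h₃ := h₂.fderiv_eq (𝕜 := ℝ)
  rw [h₁.fderiv, (key (hG.conformal hφ)).fderiv] at h₃
  have h₄ := congrArg (fun L : E →L[ℝ] ℝ ↦ L a) h₃
  simp at h₄
  rw [h₄, neg_mul]
  ring

/-- The Christoffel symbols of `e^{-2φ} G`. -/
theorem IsCoordMetricAt.christoffel_coordConformal (hG : IsCoordMetricAt G x)
    (hφ : ContDiffAt ℝ 2 φ x) (u v : E) :
    christoffel (coordConformal G φ) x u v =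
      christoffel G x u v - fderiv ℝ φ x u • v - fderiv ℝ φ x v • u
        + G x u v • coordGradient G φ x := by
  have hi := hG.isInvertible.self_of_nhds
  have hi' := (hG.conformal hφ).isInvertible.self_of_nhds
  have hd := hG.eventually_differentiableAt.self_of_nhds
  have hφd := hφ.differentiableAt (by simp)
  apply hi'.injective
  ext w
  rw [apply_christoffel hi', coordConformal_apply]
  simp only [map_add, map_sub, map_smul, add_apply, sub_apply, smul_apply, smul_eq_mul,
    apply_christoffel hi, apply_coordGradient hi, fderiv_coordConformal hd hφd]
  ring

/-- The weighted directional curvature `R̄_φ^u(v, v)` in coordinates, for constant `u`, `v`. The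
term `G(∇φ, u)` is written as `dφ(u)`. -/
noncomputable def coordWeightedDirectional (G : E → E →L[ℝ] E →L[ℝ] ℝ) (φ : E → ℝ)
    (x u v : E) : ℝ :=
  G x (coordCurvature G (fun _ ↦ v) (fun _ ↦ u) (fun _ ↦ u) x) v +
    (1 / 2 * coordLieDeriv G (coordGradient G φ) (fun _ ↦ u) (fun _ ↦ u) x
      + fderiv ℝ φ x u ^ 2) * G x v v

theorem IsCoordMetricAt.coordWeightedDirectional_eq [CompleteSpace E] (hG : IsCoordMetricAt G x)
    (hφ : ContDiffAt ℝ 2 φ x) (u v : E) :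
    coordWeightedDirectional G φ x u v =
      fderiv ℝ (fderiv ℝ G) x v u v u - 1 / 2 * fderiv ℝ (fderiv ℝ G) x v v u u
        - 1 / 2 * fderiv ℝ (fderiv ℝ G) x u u v v
        - G x (christoffel G x v v) (christoffel G x u u)
        + G x (christoffel G x v u) (christoffel G x v u)
        + (fderiv ℝ (fderiv ℝ φ) x u u - fderiv ℝ φ x (christoffel G x u u)
          + fderiv ℝ φ x u ^ 2) * G x v v := by
  rw [coordWeightedDirectional, hG.apply_coordCurvature, hG.half_coordLieDeriv hφ]

theorem IsCoordMetricAt.coordWeightedDirectional_smul [CompleteSpace E]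
    (hG : IsCoordMetricAt G x) (hφ : ContDiffAt ℝ 2 φ x) (a b : ℝ) (u v : E) :
    coordWeightedDirectional G φ x (a • u) (b • v) =
      a ^ 2 * b ^ 2 * coordWeightedDirectional G φ x u v := by
  have h : ∀ (s t : ℝ) (c d : E),
      christoffel G x (s • c) (t • d) = (s * t) • christoffel G x c d := fun s t c d ↦ by
    have hi := hG.isInvertible.self_of_nhds
    apply hi.injective
    ext w
    simp only [map_smul, smul_apply, apply_christoffel hi, smul_eq_mul]
    ring
  simp only [hG.coordWeightedDirectional_eq hφ, h, map_smul, smul_apply, smul_eq_mul]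
  ring

/-- The conformal duality in coordinates. All the terms are expressed through the derivatives of
`G` and `φ` by the formulas above; since `G(u, v) = 0`, the mixed second derivatives of `φ` drop
out, and the two sides agree as polynomials in what is left. -/
theorem IsCoordMetricAt.coordWeightedDirectional_coordConformal [CompleteSpace E]
    (hG : IsCoordMetricAt G x) (hφ : ContDiffAt ℝ 2 φ x) {u v : E} (huv : G x u v = 0) :
    coordWeightedDirectional (coordConformal G φ) (-φ) x v u =
      Real.exp (-2 * φ x) * coordWeightedDirectional G φ x u v := by
  have hi := hG.isInvertible.self_of_nhds
  have hsymm : ∀ a b : E, fderiv ℝ (fderiv ℝ G) x a b = fderiv ℝ (fderiv ℝ G) x b a :=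
    fun a b ↦ (hG.contDiffAt.isSymmSndFDerivAt (by simp)) a b
  have hneg : fderiv ℝ (-φ) = -fderiv ℝ φ := by
    ext1 y
    exact fderiv_neg
  have hneg' : fderiv ℝ (-fderiv ℝ φ) x = -fderiv ℝ (fderiv ℝ φ) x :=
    fderiv_neg
  rw [hG.coordWeightedDirectional_eq hφ,
    (hG.conformal hφ).coordWeightedDirectional_eq (φ := -φ) hφ.neg]
  have hN : ∀ w, G x w (coordGradient G φ x) = fderiv ℝ φ x w := fun w ↦ by
    rw [hG.symm, apply_coordGradient hi]
  simp only [hG.fderiv_fderiv_coordConformal hφ, hG.christoffel_coordConformal hφ,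
    coordConformal_apply, hneg, hneg', huv]
  simp only [Pi.neg_apply, neg_apply, map_add, map_sub, map_smul, add_apply, sub_apply,
    smul_apply, smul_eq_mul, apply_coordGradient hi, hN, huv, hG.symm x v u]
  have hΓ : ∀ a b c : E, G x a (christoffel G x b c) = G x (christoffel G x b c) a :=
    fun _ _ _ ↦ hG.symm x _ _
  rw [hG.symm x (christoffel G x u u) (christoffel G x v v), hG.christoffel_symm u v,
    hsymm u v, hG.fderiv_fderiv_symm v u u v]
  simp only [hΓ u, hΓ v, apply_christoffel hi _ _ u, apply_christoffel hi _ _ v]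
  rw [hG.fderiv_symm u u v, hG.fderiv_symm v u v]
  ring

end ConformalCoordinates

/-! ### Passage to the chart around a point -/

section Chart

open Filter Topology

variable {E : Type*} [NormedAddCommGroup E] [NormedSpace ℝ E]

/-- A positive definite bilinear form on a finite-dimensional space is nondegenerate. -/
theorem isInvertible_of_pos [FiniteDimensional ℝ E] {B : E →L[ℝ] E →L[ℝ] ℝ}
    (h : ∀ v, v ≠ 0 → 0 < B v v) :
    B.IsInvertible := by
  have hB : Function.Injective B := by
    refine (injective_iff_map_eq_zero B).2 fun v hv ↦ ?_
    by_contra h₀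
    have := h v h₀
    simp [hv] at this
  have hrank : Module.finrank ℝ E = Module.finrank ℝ (E →L[ℝ] ℝ) := by
    rw [← (LinearMap.toContinuousLinearMap (𝕜 := ℝ) (E := E) (F' := ℝ)).finrank_eq]
    exact Subspace.dual_finrank_eq.symm
  refine ⟨(LinearEquiv.ofInjectiveOfFinrankEq (B : E →ₗ[ℝ] E →L[ℝ] ℝ) hB
    hrank).toContinuousLinearEquiv, ?_⟩
  ext u v
  rfl

variable {H : Type*} [TopologicalSpace H] {I : ModelWithCorners ℝ E H}
  {M : Type*} [TopologicalSpace M] [ChartedSpace H M] [IsManifold I ∞ M]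

theorem chartMetric_apply (g : Metric I M) (p : M) (y u v : E) :
    chartMetric g p y u v = g.inner ((extChartAt I p).symm y)
      (chartSymmDeriv (I := I) p y u) (chartSymmDeriv (I := I) p y v) :=
  rfl

/-- The tangent space at `p` is modelled on `E` through the preferred chart at `p`, so the
differential of this chart at `p` is the identity. -/
theorem chartDeriv_apply (p : M) (v : TangentSpace I p) : chartDeriv p v = (v : E) := by
  have : IsManifold I 1 M := .of_le (n := ∞) (by simp)
  rw [chartDeriv, mfderiv_extChartAt_self]
  rfl

theorem isInvertible_chartDeriv (p : M) : (chartDeriv (I := I) p).IsInvertible := by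
  have : IsManifold I 1 M := .of_le (n := ∞) (by simp)
  exact isInvertible_mfderiv_extChartAt (mem_extChartAt_source p)

theorem isInvertible_inner [FiniteDimensional ℝ E] (g : Metric I M) (p : M) :
    (g.inner p).IsInvertible :=
  isInvertible_of_pos (E := E) (B := g.inner p) (g.pos p)

theorem inner_gradient [FiniteDimensional ℝ E] (g : Metric I M) (f : C^∞⟮I, M; ℝ⟯) (p : M)
    (v : TangentSpace I p) :
    g.inner p (gradient g f p) v = mfderiv I 𝓘(ℝ, ℝ) f p v := by
  exact DFunLike.congr_fun ((isInvertible_inner g p).self_apply_inverse _) v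

variable [I.Boundaryless]

theorem isInvertible_chartSymmDeriv {p : M} {y : E} (hy : y ∈ (extChartAt I p).target) :
    (chartSymmDeriv (I := I) p y).IsInvertible := by
  have : IsManifold I 1 M := .of_le (n := ∞) (by simp)
  have h := isInvertible_mfderivWithin_extChartAt_symm hy
  rwa [I.range_eq_univ, mfderivWithin_univ] at h

/-- In the chart around `p`, the metric at the image of `p` is the metric at `p`. -/
theorem chartMetric_chartDeriv (g : Metric I M) (p : M) (u v : TangentSpace I p) :
    chartMetric g p (extChartAt I p p) (chartDeriv p u) (chartDeriv p v) = g.inner p u v := by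
  have : IsManifold I 1 M := .of_le (n := ∞) (by simp)
  have h : chartSymmDeriv (I := I) p (extChartAt I p p) = ContinuousLinearMap.id ℝ E := by
    have h' := mfderivWithin_range_extChartAt_symm (I := I) (x := p)
    rwa [I.range_eq_univ, mfderivWithin_univ] at h'
  -- The base point `symm (extChartAt I p p)` is equal to `p`, but not by definition.
  have key : ∀ q : M, q = p → ∀ a b : E, g.inner q a b = g.inner p a b := by
    rintro q rfl a b
    rfl
  rw [chartMetric_apply, h, chartDeriv_apply, chartDeriv_apply]
  exact key _ (extChartAt_to_inv p) u v

/-- The coordinate vector field with constant coordinates `u` is smooth on the chart target. -/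
theorem contMDiffOn_chartSymmDeriv (p : M) (u : E) :
    ContMDiffOn 𝓘(ℝ, E) I.tangent ∞
      (fun y : E ↦ (⟨(extChartAt I p).symm y, chartSymmDeriv (I := I) p y u⟩ : TangentBundle I M))
      (extChartAt I p).target := by
  have ho := isOpen_extChartAt_target (I := I) p
  have h := (contMDiffOn_extChartAt_symm (I := I) (n := ∞) p).contMDiffOn_tangentMapWithin
    (m := ∞) (by simp) ho.uniqueMDiffOn
  have hc : ContMDiff 𝓘(ℝ, E) 𝓘(ℝ, E).tangent ∞
      (fun y : E ↦ (⟨y, u⟩ : TangentBundle 𝓘(ℝ, E) E)) :=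
    contMDiff_vectorSpace_iff_contDiff.2 contDiff_const
  refine (h.comp hc.contMDiffOn fun y hy ↦ hy).congr fun y hy ↦ ?_
  simp only [Function.comp_apply, tangentMapWithin, chartSymmDeriv]
  rw [mfderivWithin_of_isOpen ho hy]
  rfl

/-- A function on `M` written in the chart around `p`. -/
noncomputable def chartFun (f : C^∞⟮I, M; ℝ⟯) (p : M) : E → ℝ :=
  f ∘ (extChartAt I p).symm

theorem contDiffAt_chartFun (f : C^∞⟮I, M; ℝ⟯) (p : M) :
    ContDiffAt ℝ 2 (chartFun f p) (extChartAt I p p) := by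
  have h : ContMDiffOn 𝓘(ℝ, E) 𝓘(ℝ, ℝ) ∞ (chartFun f p) (extChartAt I p).target :=
    f.contMDiff.comp_contMDiffOn (contMDiffOn_extChartAt_symm p)
  exact ((contMDiffOn_iff_contDiffOn.1 h).contDiffAt (extChartAt_target_mem_nhds p)).of_le
    (ENat.LEInfty.out)

theorem fderiv_chartFun (f : C^∞⟮I, M; ℝ⟯) {p : M} {y : E}
    (hy : y ∈ (extChartAt I p).target) (v : E) :
    fderiv ℝ (chartFun f p) y v =
      mfderiv I 𝓘(ℝ, ℝ) f ((extChartAt I p).symm y) (chartSymmDeriv (I := I) p y v) := by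
  have h₁ : MDifferentiableAt 𝓘(ℝ, E) I (extChartAt I p).symm y :=
    ((contMDiffOn_extChartAt_symm (I := I) (n := ∞) p).contMDiffAt
      ((isOpen_extChartAt_target p).mem_nhds hy)).mdifferentiableAt (by simp)
  have h₂ := f.contMDiff.mdifferentiableAt (by simp) (x := (extChartAt I p).symm y)
  rw [← mfderiv_eq_fderiv]
  exact mfderiv_comp_apply y h₂ h₁ v

theorem fderiv_chartFun_chartDeriv (f : C^∞⟮I, M; ℝ⟯) (p : M) (v : TangentSpace I p) :
    fderiv ℝ (chartFun f p) (extChartAt I p p) (chartDeriv p v) = mfderiv I 𝓘(ℝ, ℝ) f p v := by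
  have h₁ : MDifferentiableAt I 𝓘(ℝ, E) (extChartAt I p) p :=
    (contMDiffAt_extChartAt (n := ∞)).mdifferentiableAt (by simp)
  have h₂ := ((contDiffAt_chartFun f p).differentiableAt (by simp)).mdifferentiableAt
  have h : (f : M → ℝ) =ᶠ[𝓝 p] chartFun f p ∘ extChartAt I p := by
    filter_upwards [extChartAt_source_mem_nhds (I := I) p] with q hq
    simp only [chartFun, Function.comp_apply, (extChartAt I p).left_inv hq]
  rw [h.mfderiv_eq, ← mfderiv_eq_fderiv]
  exact (mfderiv_comp_apply p h₂ h₁ v).symm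

variable [FiniteDimensional ℝ E]

theorem isInvertible_chartMetric (g : Metric I M) {p : M} {y : E}
    (hy : y ∈ (extChartAt I p).target) : (chartMetric g p y).IsInvertible := by
  refine isInvertible_of_pos fun v hv ↦ ?_
  rw [chartMetric_apply]
  apply g.pos
  rw [← map_zero (chartSymmDeriv (I := I) p y)]
  exact (isInvertible_chartSymmDeriv hy).injective.ne hv

theorem contDiffOn_chartMetric (g : Metric I M) (p : M) :
    ContDiffOn ℝ ∞ (chartMetric g p) (extChartAt I p).target := by
  refine contDiffOn_clm_apply.2 fun u ↦ contDiffOn_clm_apply.2 fun v ↦ ?_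
  rw [← contMDiffOn_iff_contDiffOn]
  intro y hy
  have h : ContMDiffWithinAt 𝓘(ℝ, E) (I.prod 𝓘(ℝ, ℝ)) ∞
      (fun z ↦ Bundle.TotalSpace.mk' ℝ (E := Bundle.Trivial M ℝ) ((extChartAt I p).symm z)
        (chartMetric g p z u v)) (extChartAt I p).target y :=
    ContMDiffWithinAt.clm_bundle_apply₂ (F₁ := E) (F₂ := E)
      (E₁ := (TangentSpace I : M → Type _)) (E₂ := (TangentSpace I : M → Type _))
      (E₃ := Bundle.Trivial M ℝ) (ψ := fun z ↦ g.inner ((extChartAt I p).symm z))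
      (v := fun z ↦ chartSymmDeriv (I := I) p z u) (w := fun z ↦ chartSymmDeriv (I := I) p z v)
      (g.contMDiff.contMDiffAt.comp_contMDiffWithinAt y
        (contMDiffOn_extChartAt_symm (I := I) (n := ∞) p y hy))
      (contMDiffOn_chartSymmDeriv p u y hy) (contMDiffOn_chartSymmDeriv p v y hy)
  -- The second component of a section of the trivial line bundle is the function itself.
  rw [Bundle.contMDiffWithinAt_totalSpace] at h
  exact h.2

theorem isCoordMetricAt_chartMetric (g : Metric I M) (p : M) :
    IsCoordMetricAt (chartMetric g p) (extChartAt I p p) where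
  contDiffAt := ((contDiffOn_chartMetric g p).contDiffAt
    (extChartAt_target_mem_nhds p)).of_le (ENat.LEInfty.out)
  symm y u v := g.symm _ _ _
  isInvertible := by
    filter_upwards [extChartAt_target_mem_nhds (I := I) p] with y hy
    exact isInvertible_chartMetric g hy

/-- The gradient in the chart around `p` is the gradient for the metric in that chart. -/
theorem chartField_gradient (g : Metric I M) (f : C^∞⟮I, M; ℝ⟯) {p : M} {y : E}
    (hy : y ∈ (extChartAt I p).target) :
    chartField (gradient g f) p y = coordGradient (chartMetric g p) (chartFun f p) y := by
  have hi := isInvertible_chartMetric g hy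
  apply hi.injective
  ext v
  rw [apply_coordGradient hi, chartMetric_apply, chartField,
    (isInvertible_chartSymmDeriv hy).self_apply_inverse, inner_gradient, fderiv_chartFun f hy]

/-- The weighted directional curvature is computed in the chart by its coordinate expression. -/
theorem weightedDirectionalFun_eq (g : Metric I M) (f : C^∞⟮I, M; ℝ⟯) (p : M)
    (u v : TangentSpace I p) :
    weightedDirectionalFun g f p u v v =
      coordWeightedDirectional (chartMetric g p) (chartFun f p) (extChartAt I p p)
        (chartDeriv p u) (chartDeriv p v) := by
  have hX : chartField (gradient g f) p =ᶠ[𝓝 (extChartAt I p p)]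
      coordGradient (chartMetric g p) (chartFun f p) := by
    filter_upwards [extChartAt_target_mem_nhds (I := I) p] with y hy
    exact chartField_gradient g f hy
  have hL : lieDeriv g (gradient g f) p u u =
      coordLieDeriv (chartMetric g p) (coordGradient (chartMetric g p) (chartFun f p))
        (fun _ ↦ chartDeriv p u) (fun _ ↦ chartDeriv p u) (extChartAt I p p) := by
    simp only [lieDeriv, coordLieDeriv, VectorField.lieBracket, hX.fderiv_eq, hX.self_of_nhds]
  rw [weightedDirectionalFun, weightedDirectional, weightedDirectionalOp, map_add, map_smul,
    add_apply, smul_apply, smul_eq_mul, hL, inner_gradient, ← fderiv_chartFun_chartDeriv,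
    coordWeightedDirectional, chartMetric_chartDeriv, directional, curvature,
    ← chartMetric_chartDeriv g p ((chartDeriv p).inverse _),
    (isInvertible_chartDeriv p).self_apply_inverse]

end Chart

/-! ### Conformal duality on the manifold -/

section ConformalDuality

variable {E : Type*} [NormedAddCommGroup E] [NormedSpace ℝ E]
  {H : Type*} [TopologicalSpace H] {I : ModelWithCorners ℝ E H}
  {M : Type*} [TopologicalSpace M] [ChartedSpace H M] [IsManifold I ∞ M]

theorem inner_conformal (g : Metric I M) (f : C^∞⟮I, M; ℝ⟯) (p : M) (u v : TangentSpace I p) :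
    (conformal g f).inner p u v = Real.exp (-2 * f p) * g.inner p u v := by
  simp [conformal]

theorem chartMetric_conformal (g : Metric I M) (f : C^∞⟮I, M; ℝ⟯) (p : M) :
    chartMetric (conformal g f) p = coordConformal (chartMetric g p) (chartFun f p) := by
  ext y u v
  rw [coordConformal_apply, chartMetric_apply, chartMetric_apply, inner_conformal]
  rfl

omit [IsManifold I ∞ M] in
theorem chartFun_neg (f : C^∞⟮I, M; ℝ⟯) (p : M) : chartFun (-f) p = -chartFun f p := rfl

theorem metric_ext {g h : Metric I M} (H : ∀ p u v, g.inner p u v = h.inner p u v) : g = h := by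
  have : g.inner = h.inner := by
    ext p u v
    exact H p u v
  cases g
  cases h
  congr

variable (I M) in
theorem conformalDual_involutive :
    Function.Involutive
      (conformalDual : Metric I M × C^∞⟮I, M; ℝ⟯ → Metric I M × C^∞⟮I, M; ℝ⟯) := by
  rintro ⟨g, f⟩
  refine Prod.ext (metric_ext fun p u v ↦ ?_) (neg_neg f)
  simp only [conformalDual]
  rw [inner_conformal, inner_conformal, ← mul_assoc, ← Real.exp_add]
  simp

theorem IsOrthonormalPair.conformal {g : Metric I M} {p : M} {u v : TangentSpace I p}
    (h : IsOrthonormalPair g p u v) (f : C^∞⟮I, M; ℝ⟯) :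
    IsOrthonormalPair (conformal g f) p (Real.exp (f p) • v) (Real.exp (f p) • u) := by
  obtain ⟨hu, hv, huv⟩ := h
  have he : Real.exp (f p) * (Real.exp (f p) * Real.exp (-2 * f p)) = 1 := by
    rw [← Real.exp_add, ← Real.exp_add, Real.exp_eq_one_iff]
    ring
  simp only [IsOrthonormalPair, inner_conformal, map_smul, smul_apply, smul_eq_mul, hu, hv,
    g.symm p v u, huv, mul_zero, mul_one, he, and_self]

/-- On orthonormal pairs the denominator of the sectional curvature is `1`. -/
theorem weightedSecFun_eq_weightedDirectionalFun {g : Metric I M} (f : C^∞⟮I, M; ℝ⟯) {p : M}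
    {u v : TangentSpace I p} (h : IsOrthonormalPair g p u v) :
    weightedSecFun g f p u v = weightedDirectionalFun g f p u v v := by
  obtain ⟨hu, hv, huv⟩ := h
  rw [weightedSecFun, weightedSec, sectional, weightedDirectionalFun, weightedDirectional,
    weightedDirectionalOp, map_add, map_smul, add_apply, smul_apply, hu, hv, huv, smul_eq_mul]
  ring

variable [FiniteDimensional ℝ E] [I.Boundaryless]

theorem weightedDirectionalFun_smul (g : Metric I M) (f : C^∞⟮I, M; ℝ⟯) (p : M) (a b : ℝ)
    (u v : TangentSpace I p) :
    weightedDirectionalFun g f p (a • u) (b • v) (b • v) =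
      a ^ 2 * b ^ 2 * weightedDirectionalFun g f p u v v := by
  have : CompleteSpace E := FiniteDimensional.complete ℝ E
  rw [weightedDirectionalFun_eq, weightedDirectionalFun_eq, map_smul, map_smul,
    (isCoordMetricAt_chartMetric g p).coordWeightedDirectional_smul (contDiffAt_chartFun f p)]

/-- The duality of weighted directional curvatures under the conformal change `e^{-2f} g`, for
orthogonal vectors. -/
theorem weightedDirectionalFun_conformal (g : Metric I M) (f : C^∞⟮I, M; ℝ⟯) (p : M)
    {u v : TangentSpace I p} (h : g.inner p u v = 0) :
    weightedDirectionalFun g f p u v v =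
      Real.exp (2 * f p) * weightedDirectionalFun (conformal g f) (-f) p v u u := by
  have : CompleteSpace E := FiniteDimensional.complete ℝ E
  have hf : chartFun f p (extChartAt I p p) = f p := by simp [chartFun]
  rw [← chartMetric_chartDeriv] at h
  rw [weightedDirectionalFun_eq, weightedDirectionalFun_eq, chartMetric_conformal, chartFun_neg,
    (isCoordMetricAt_chartMetric g p).coordWeightedDirectional_coordConformal
      (contDiffAt_chartFun f p) h, hf, ← mul_assoc, ← Real.exp_add]
  simp

theorem weightedSecFun_conformal (g : Metric I M) (f : C^∞⟮I, M; ℝ⟯) (p : M)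
    {u v : TangentSpace I p} (h : IsOrthonormalPair g p u v) :
    weightedSecFun g f p u v =
      Real.exp (-2 * f p) * weightedSecFun (conformal g f) (-f) p
        (Real.exp (f p) • v) (Real.exp (f p) • u) := by
  rw [weightedSecFun_eq_weightedDirectionalFun f h,
    weightedSecFun_eq_weightedDirectionalFun (-f) (h.conformal f),
    weightedDirectionalFun_smul, weightedDirectionalFun_conformal g f p h.2.2, ← mul_assoc]
  congr 1
  simp only [← Real.exp_nat_mul, ← Real.exp_add]
  ring_nf

/-- Every value of `sec̄` for the dual pair is `e^{2f}` times a value of `sec̄` for the pair. -/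
theorem exists_weightedSecFun_conformalDual (P : Metric I M × C^∞⟮I, M; ℝ⟯) {p : M}
    {u v : TangentSpace I p} (h : IsOrthonormalPair (conformalDual P).1 p u v) :
    ∃ u' v', IsOrthonormalPair P.1 p u' v' ∧
      weightedSecFun (conformalDual P).1 (conformalDual P).2 p u v =
        Real.exp (2 * P.2 p) * weightedSecFun P.1 P.2 p u' v' := by
  have hP := conformalDual_involutive I M P
  -- The dual of the dual pair is the pair itself, so both facts are those for the dual pair.
  have h₁ : IsOrthonormalPair (conformalDual (conformalDual P)).1 p _ _ :=
    h.conformal (conformalDual P).2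
  have h₂ : _ = _ * weightedSecFun (conformalDual (conformalDual P)).1
      (conformalDual (conformalDual P)).2 p _ _ :=
    weightedSecFun_conformal (conformalDual P).1 (conformalDual P).2 p h
  rw [hP] at h₁ h₂
  refine ⟨_, _, h₁, h₂.trans ?_⟩
  simp [conformalDual]

theorem WeightedSecEq.conformalDual {P : Metric I M × C^∞⟮I, M; ℝ⟯} {φ : M → ℝ}
    (h : WeightedSecEq P.1 P.2 φ) :
    WeightedSecEq (conformalDual P).1 (conformalDual P).2
      (fun p ↦ Real.exp (2 * P.2 p) * φ p) := by
  intro p u v huv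
  obtain ⟨u', v', h', e⟩ := exists_weightedSecFun_conformalDual P huv
  rw [e, h p u' v' h']

theorem WeightedSecGe.conformalDual {P : Metric I M × C^∞⟮I, M; ℝ⟯}
    (h : WeightedSecGe P.1 P.2 (fun _ ↦ 0)) :
    WeightedSecGe (conformalDual P).1 (conformalDual P).2 (fun _ ↦ 0) := by
  intro p u v huv
  obtain ⟨u', v', h', e⟩ := exists_weightedSecFun_conformalDual P huv
  rw [e]
  exact mul_nonneg (Real.exp_pos _).le (h p u' v' h')

theorem WeightedSecLe.conformalDual {P : Metric I M × C^∞⟮I, M; ℝ⟯}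
    (h : WeightedSecLe P.1 P.2 (fun _ ↦ 0)) :
    WeightedSecLe (conformalDual P).1 (conformalDual P).2 (fun _ ↦ 0) := by
  intro p u v huv
  obtain ⟨u', v', h', e⟩ := exists_weightedSecFun_conformalDual P huv
  rw [e]
  exact mul_nonpos_of_nonneg_of_nonpos (Real.exp_pos _).le (h p u' v' h')

end ConformalDuality

end WeightedCurvature

theorem mainTheorem10
    {E : Type*} [NormedAddCommGroup E] [NormedSpace ℝ E] [FiniteDimensional ℝ E]
    {H : Type*} [TopologicalSpace H] {I : ModelWithCorners ℝ E H} [I.Boundaryless]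
    {M : Type*} [TopologicalSpace M] [ChartedSpace H M] [IsManifold I ∞ M] :
    (∀ (g : WeightedCurvature.Metric I M) (f : C^∞⟮I, M; ℝ⟯) (p : M) (U V : TangentSpace I p),
      g.inner p U V = 0 →
        WeightedCurvature.weightedDirectionalFun g f p U V V =
          Real.exp (2 * f p) * WeightedCurvature.weightedDirectionalFun
            (WeightedCurvature.conformal g f) (-f) p V U U) ∧
    (∀ (g : WeightedCurvature.Metric I M) (f : C^∞⟮I, M; ℝ⟯) (p : M) (U V : TangentSpace I p),
      WeightedCurvature.IsOrthonormalPair g p U V →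
        WeightedCurvature.IsOrthonormalPair (WeightedCurvature.conformal g f) p
          (Real.exp (f p) • V) (Real.exp (f p) • U) ∧
        WeightedCurvature.weightedSecFun g f p U V =
          Real.exp (-2 * f p) * WeightedCurvature.weightedSecFun
            (WeightedCurvature.conformal g f) (-f) p
            (Real.exp (f p) • V) (Real.exp (f p) • U)) ∧
    Function.Involutive
      (WeightedCurvature.conformalDual :
        WeightedCurvature.Metric I M × C^∞⟮I, M; ℝ⟯ →
          WeightedCurvature.Metric I M × C^∞⟮I, M; ℝ⟯) ∧
    (∀ (P : WeightedCurvature.Metric I M × C^∞⟮I, M; ℝ⟯),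
      (∀ φ : M → ℝ, WeightedCurvature.WeightedSecEq P.1 P.2 φ ↔
        WeightedCurvature.WeightedSecEq (WeightedCurvature.conformalDual P).1
          (WeightedCurvature.conformalDual P).2 (fun p ↦ Real.exp (2 * P.2 p) * φ p)) ∧
      (WeightedCurvature.WeightedSecGe P.1 P.2 (fun _ ↦ 0) ↔
        WeightedCurvature.WeightedSecGe (WeightedCurvature.conformalDual P).1
          (WeightedCurvature.conformalDual P).2 (fun _ ↦ 0)) ∧
      (WeightedCurvature.WeightedSecLe P.1 P.2 (fun _ ↦ 0) ↔
        WeightedCurvature.WeightedSecLe (WeightedCurvature.conformalDual P).1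
          (WeightedCurvature.conformalDual P).2 (fun _ ↦ 0))) := by
  have hinv := WeightedCurvature.conformalDual_involutive I M
  refine ⟨fun g f p U V h ↦ WeightedCurvature.weightedDirectionalFun_conformal g f p h,
    fun g f p U V h ↦ ⟨h.conformal f, WeightedCurvature.weightedSecFun_conformal g f p h⟩, hinv,
    fun P ↦ ⟨fun φ ↦ ⟨fun h ↦ h.conformalDual, fun h ↦ ?_⟩,
      ⟨fun h ↦ h.conformalDual, fun h ↦ ?_⟩, ⟨fun h ↦ h.conformalDual, fun h ↦ ?_⟩⟩⟩
  · have h' := h.conformalDual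
    -- The two conformal factors `e^{2f}` and `e^{-2f}` cancel.
    rw [hinv] at h'
    intro p U V hUV
    simp only [h' p U V hUV]
    rw [← mul_assoc, ← Real.exp_add]
    simp [WeightedCurvature.conformalDual]
  · simpa only [hinv P] using h.conformalDual
  · simpa only [hinv P] using h.conformalDual
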